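/- Let $k$ be a field and $q\in k^{\times}$. Let $H_q$ be the $k$-algebra generated by $D_1,D_2,\sigma^{\pm1}$ with relations $D_1D_2=D_2D_1$, $\sigma\sigma^{-1}=\sigma^{-1}\sigma=1$, $q\sigma D_i=D_i\sigma$ ($i=1,2$) and, if $q$ is a primitive $l$-th root of unity with $l\ge 2$, also $D_1^l=D_2^l=0$; it is a bialgebra with $\Delta(D_1)=D_1\otimes\sigma+1\otimes D_1$, $\Delta(D_2)=D_2\otimes 1+\sigma\otimes D_2$, $\Delta(\sigma)=\sigma\otimes\sigma$, $\epsilon(D_i)=0$, $\epsilon(\sigma)=1$. We write $c$ for the flip of $H_q\otimes H_q$. For a $k$-algebra $A$, a left transposition of $H_q$ on $A$ is a bijective linear map $s\colon H_q\otimes A\to A\otimes H_q$ that is compatible with the multiplication and unit of $H_q$, with the comultiplication and counit of $H_q$, with $c$ (that is, $(s\otimes H_q)(H_q\otimes s)(c\otimes A)=(A\otimes c)(s\otimes H_q)(H_q\otimes s)$), and with the multiplication and unit of $A$. It is good if $(s\otimes H_q)(H_q\otimes s)(D_1\otimes D_2\otimes a)=a\otimes D_1\otimes D_2$ for all $a\in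 A$. An $H_q$-module algebra structure on $(A,s)$ is a left $H_q$-module structure $\rho\colon H_q\otimes A\to A$, $\rho(h\otimes a)=h\cdot a$, with $s(H_q\otimes\rho)=(\rho\otimes H_q)(H_q\otimes s)(c\otimes A)$, $\rho(H_q\otimes\mu_A)=\mu_A(\rho\otimes\rho)(H_q\otimes s\otimes A)(\Delta\otimes A\otimes A)$ and $h\cdot 1=\epsilon(h)1$ for all $h\in H_q$. Let $G$ be a group acting linearly on a finite-dimensional $k$-vector space $V$, and extend the action to $S(V)$ by algebra automorphisms. Let $f\colon G\times G\to k^{\times}$ be a normal (i.e. normalized) $2$-cocycle, and let $A=S(V)\#_fG$ be the free left $S(V)$-module with basis $\{w_g: g\in G\}$ and product $(Pw_g)(Qw_h)=P\,{}^g\!Q\,f(g,h)w_{gh}$. Let $\hat\alpha\colon V\to V$ be a bijective $k[G]$-linear map, $\chi_\alpha\colon G\to k^\times$ a group homomorphism, and $s\colon H_q\otimes A\to A\otimes H_q$ the good left transposition with $s(D_1\otimes v)=\hat\alpha(v)\otimes D_1$ and $s(D_1\otimes w_g)=\chi_\alpha(g)w_g\otimes D_1$ for all $v\in V$, $g\in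 G$. Let $\hat\varsigma\colon V\to V$ and $\hat\delta_1,\hat\delta_2\colon V\to A$ be linear maps and $\chi_\varsigma\colon G\to k^\times$ a map. Assume that $\ker\hat\delta_1\ne\ker\hat\delta_2$ both have codimension $1$ in $V$, and that there are $x_1\in\ker\hat\delta_2\setminus\ker\hat\delta_1$ and $x_2\in\ker\hat\delta_1\setminus\ker\hat\delta_2$ and, for each $i\in\{1,2\}$, distinct elements $g_{i1},\dots,g_{in_i}$ of $G$ and polynomials $P^{(i)}_{g_{i1}},\dots,P^{(i)}_{g_{in_i}}\in S(V)\setminus\{0\}$ such that $\hat\delta_i(x_i)=\sum_{j=1}^{n_i}P^{(i)}_{g_{ij}}w_{g_{ij}}$. For $g\in G$ and $i\in\{1,2\}$ let $\lambda_{ig}\in k$ be the scalar with ${}^g x_i-\lambda_{ig}x_i\in\ker\hat\delta_i$. Assume that there is an $H_q$-module algebra structure on $(A,s)$ such that $$\sigma\cdot v=\hat\varsigma(v),\quad \sigma\cdot w_g=\chi_\varsigma(g)w_g,\quad D_i\cdot v=\hat\delta_i(v),\quad D_i\cdot w_g=0$$ for all $v\in V$, $g\in G$, $i\in\{1,2\}$,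 and that $P^{(1)}_{g_{1j}}\in S(\ker\hat\delta_1)$ and $P^{(2)}_{g_{2h}}\in S(\ker\hat\delta_2)$ for all $1\le j\le n_1$ and $1\le h\le n_2$. Then, for all $1\le j\le n_1$ and $1\le h\le n_2$, $$\lambda_{1g_{1j}}\lambda_{1g_{2h}}=q,\qquad \lambda_{2g_{1j}}\lambda_{2g_{2h}}=q^{-1},$$ and $g_{1j}g_{2h}$ acts on $V$ with determinant $1$. -/

import Mathlib

open scoped TensorProduct

namespace BraidedHq

/-! ### The `q`-binomial theorem at a root of unity

Only used to see that the comultiplication of `H_q` is well defined. -/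

section QBinomial

variable {k : Type*} [Field k]

/-- `(i)_q = 1 + q + ⋯ + q ^ (i - 1)`. -/
def qInt (q : k) (i : ℕ) : k := ∑ j ∈ Finset.range i, q ^ j

/-- `(i)!_q = (1)_q ⋯ (i)_q`. -/
def qFact (q : k) (i : ℕ) : k := ∏ j ∈ Finset.range i, qInt q (j + 1)

/-- The Gaussian binomial coefficient of `a + b` over `a`. -/
def qBinom (q : k) : ℕ → ℕ → k
  | 0, _ => 1
  | _ + 1, 0 => 1
  | a + 1, b + 1 => qBinom q a (b + 1) + q ^ (a + 1) * qBinom q (a + 1) b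

theorem qBinom_zero_left (q : k) (b : ℕ) : qBinom q 0 b = 1 := by
  rw [qBinom]

theorem qBinom_zero_right (q : k) (a : ℕ) : qBinom q a 0 = 1 := by
  cases a <;> rw [qBinom]

theorem qBinom_succ (q : k) (a b : ℕ) : qBinom q (a + 1) (b + 1) =
    qBinom q a (b + 1) + q ^ (a + 1) * qBinom q (a + 1) b := by
  rw [qBinom]

theorem qInt_add (q : k) (a b : ℕ) : qInt q (a + b) = qInt q a + q ^ a * qInt q b := by
  simp only [qInt, Finset.sum_range_add, Finset.mul_sum, pow_add]

theorem qFact_succ (q : k) (a : ℕ) : qFact q (a + 1) = qFact q a * qInt q (a + 1) := by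
  simp [qFact, Finset.prod_range_succ]

theorem qBinom_mul (q : k) : ∀ n a b : ℕ, a + b = n →
    qBinom q a b * (qFact q a * qFact q b) = qFact q n := by
  intro n
  induction n with
  | zero =>
    intro a b h
    obtain ⟨rfl, rfl⟩ : a = 0 ∧ b = 0 := by omega
    simp [qBinom_zero_left, qFact]
  | succ n ih =>
    intro a b h
    rcases a with _ | a
    · obtain rfl : b = n + 1 := by omega
      simp [qBinom_zero_left, qFact]
    rcases b with _ | b
    · obtain rfl : a = n := by omega
      simp [qBinom_zero_right, qFact]
    have h1 := ih a (b + 1) (by omega)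
    have h2 := ih (a + 1) b (by omega)
    have h3 : qInt q (n + 1) = qInt q (a + 1) + q ^ (a + 1) * qInt q (b + 1) := by
      rw [← qInt_add]
      congr 1
      omega
    rw [qBinom_succ, qFact_succ q n, h3, mul_add]
    nth_rewrite 1 [← h1]
    rw [← h2, qFact_succ q a, qFact_succ q b]
    ring

theorem qInt_ne_zero {q : k} {l : ℕ} (h : IsPrimitiveRoot q l) {i : ℕ}
    (hi : 0 < i) (hil : i < l) : qInt q i ≠ 0 := by
  intro h0
  have h1 : qInt q i * (q - 1) = q ^ i - 1 := geom_sum_mul q i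
  rw [h0, zero_mul] at h1
  exact h.pow_ne_one_of_pos_of_lt hi.ne' hil (sub_eq_zero.mp h1.symm)

theorem qFact_ne_zero {q : k} {l : ℕ} (h : IsPrimitiveRoot q l) {i : ℕ}
    (hil : i < l) : qFact q i ≠ 0 := by
  rw [qFact, Finset.prod_ne_zero_iff]
  intro j hj
  rw [Finset.mem_range] at hj
  exact qInt_ne_zero h (by omega) (by omega)

theorem qFact_eq_zero {q : k} {l : ℕ} (hl : 2 ≤ l) (h : IsPrimitiveRoot q l) :
    qFact q l = 0 := by
  rw [qFact, Finset.prod_eq_zero_iff]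
  refine ⟨l - 1, by rw [Finset.mem_range]; omega, ?_⟩
  rw [Nat.sub_add_cancel (by omega)]
  exact h.geom_sum_eq_zero (by omega)

theorem qBinom_eq_zero {q : k} {l : ℕ} (hl : 2 ≤ l) (h : IsPrimitiveRoot q l) {a b : ℕ}
    (ha : a ≠ 0) (hb : b ≠ 0) (hab : a + b = l) : qBinom q a b = 0 := by
  have h1 := qBinom_mul q l a b hab
  rw [qFact_eq_zero hl h] at h1
  exact (mul_eq_zero.mp h1).resolve_right
    (mul_ne_zero (qFact_ne_zero h (by omega)) (qFact_ne_zero h (by omega)))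

variable {R : Type*} [Ring R] [Algebra k R]

theorem mul_pow_of_qcomm {q : k} {x y : R} (h : y * x = q • (x * y)) (a : ℕ) :
    y * x ^ a = q ^ a • (x ^ a * y) := by
  induction a with
  | zero => simp
  | succ a ih =>
    rw [pow_succ, ← mul_assoc, ih, smul_mul_assoc, mul_assoc, h, mul_smul_comm, smul_smul,
      ← mul_assoc, pow_succ]

theorem add_pow_of_qcomm {q : k} {x y : R} (h : y * x = q • (x * y)) (n : ℕ) :
    (x + y) ^ n = ∑ p ∈ Finset.HasAntidiagonal.antidiagonal n, qBinom q p.1 p.2 • (x ^ p.1 * y ^ p.2) := by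
  induction n with
  | zero => simp [qBinom_zero_left]
  | succ n ih =>
    have key : ∀ p ∈ Finset.HasAntidiagonal.antidiagonal (n + 1),
        qBinom q p.1 p.2 • (x ^ p.1 * y ^ p.2) =
          (if p.1 = 0 then 0 else qBinom q (p.1 - 1) p.2) • (x ^ p.1 * y ^ p.2) +
          (if p.2 = 0 then 0 else q ^ p.1 * qBinom q p.1 (p.2 - 1)) • (x ^ p.1 * y ^ p.2) := by
      rintro ⟨a, b⟩ hp
      rw [Finset.HasAntidiagonal.mem_antidiagonal] at hp
      rw [← add_smul]
      congr 1
      rcases a with _ | a <;> rcases b with _ | b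
      · simp at hp
      · simp [qBinom_zero_left]
      · simp [qBinom_zero_right]
      · simp [qBinom_succ]
    rw [Finset.sum_congr rfl key, Finset.sum_add_distrib, Finset.Nat.sum_antidiagonal_succ,
      Finset.Nat.sum_antidiagonal_succ', pow_succ', ih, add_mul, Finset.mul_sum, Finset.mul_sum]
    simp only [if_true, zero_smul, zero_add, Nat.succ_ne_zero, if_false, Nat.add_sub_cancel]
    congr 1
    · refine Finset.sum_congr rfl fun p _ => ?_
      rw [mul_smul_comm, ← mul_assoc, ← pow_succ']
    · refine Finset.sum_congr rfl fun p _ => ?_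
      rw [mul_smul_comm, ← mul_assoc, mul_pow_of_qcomm h, smul_mul_assoc, smul_smul, mul_assoc,
        ← pow_succ', mul_comm]

theorem add_pow_of_qcomm_primitive {q : k} {l : ℕ} (hl : 2 ≤ l) (hq : IsPrimitiveRoot q l)
    {x y : R} (h : y * x = q • (x * y)) : (x + y) ^ l = x ^ l + y ^ l := by
  obtain ⟨m, rfl⟩ : ∃ m, l = m + 1 := ⟨l - 1, by omega⟩
  rw [add_pow_of_qcomm h, Finset.Nat.sum_antidiagonal_succ]
  obtain ⟨m, rfl⟩ : ∃ m', m = m' + 1 := ⟨m - 1, by omega⟩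
  rw [Finset.Nat.sum_antidiagonal_succ']
  rw [Finset.sum_eq_zero]
  · simp [qBinom_zero_left, qBinom_zero_right, add_comm]
  · rintro ⟨a, b⟩ hp
    rw [Finset.HasAntidiagonal.mem_antidiagonal] at hp
    simp only at hp
    rw [qBinom_eq_zero hl hq (by omega) (by omega) (by simp only; omega), zero_smul]

end QBinomial

/-! ### The Hopf algebra `H_q` -/

section Hq

variable {k : Type*} [Field k]

/-- Names of the generators `D_1`, `D_2`, `σ`, `σ⁻¹` of `H_q`. -/
inductive Gen : Type
  | D1 : Gen
  | D2 : Gen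
  | sig : Gen
  | sigInv : Gen

/-- The defining relations of `H_q`: those of `H`, and `D_i ^ l = 0` if `q` is a primitive
`l`-th root of unity for some `l ≥ 2`. -/
inductive HqRel (q : kˣ) : FreeAlgebra k Gen → FreeAlgebra k Gen → Prop
  | comm : HqRel q (FreeAlgebra.ι k Gen.D1 * FreeAlgebra.ι k Gen.D2)
      (FreeAlgebra.ι k Gen.D2 * FreeAlgebra.ι k Gen.D1)
  | sig_mul_inv : HqRel q (FreeAlgebra.ι k Gen.sig * FreeAlgebra.ι k Gen.sigInv) 1
  | inv_mul_sig : HqRel q (FreeAlgebra.ι k Gen.sigInv * FreeAlgebra.ι k Gen.sig) 1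
  | sig_D1 : HqRel q ((q : k) • (FreeAlgebra.ι k Gen.sig * FreeAlgebra.ι k Gen.D1))
      (FreeAlgebra.ι k Gen.D1 * FreeAlgebra.ι k Gen.sig)
  | sig_D2 : HqRel q ((q : k) • (FreeAlgebra.ι k Gen.sig * FreeAlgebra.ι k Gen.D2))
      (FreeAlgebra.ι k Gen.D2 * FreeAlgebra.ι k Gen.sig)
  | D1_pow (l : ℕ) (hl : 2 ≤ l) (hq : IsPrimitiveRoot (q : k) l) :
      HqRel q (FreeAlgebra.ι k Gen.D1 ^ l) 0
  | D2_pow (l : ℕ) (hl : 2 ≤ l) (hq : IsPrimitiveRoot (q : k) l) :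
      HqRel q (FreeAlgebra.ι k Gen.D2 ^ l) 0

/-- The algebra `H_q`. -/
def Hq (q : kˣ) : Type _ := RingQuot (HqRel q)

noncomputable instance (q : kˣ) : Ring (Hq q) := inferInstanceAs (Ring (RingQuot (HqRel q)))

noncomputable instance instAlgebraHq (q : kˣ) : Algebra k (Hq q) :=
  inferInstanceAs (Algebra k (RingQuot (HqRel q)))

namespace Hq

/-- The projection of the free algebra onto `H_q`. -/
noncomputable def mk (q : kˣ) : FreeAlgebra k Gen →ₐ[k] Hq q := RingQuot.mkAlgHom k (HqRel q)

/-- The class of a generator in `H_q`. -/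
noncomputable def gen (q : kˣ) (x : Gen) : Hq q := mk q (FreeAlgebra.ι k x)

/-- `D_1 ∈ H_q`. -/
noncomputable def D1 (q : kˣ) : Hq q := gen q Gen.D1

/-- `D_2 ∈ H_q`. -/
noncomputable def D2 (q : kˣ) : Hq q := gen q Gen.D2

/-- `σ ∈ H_q`. -/
noncomputable def sig (q : kˣ) : Hq q := gen q Gen.sig

/-- `σ⁻¹ ∈ H_q`. -/
noncomputable def sigInv (q : kˣ) : Hq q := gen q Gen.sigInv

theorem mk_rel {q : kˣ} {x y : FreeAlgebra k Gen} (h : HqRel q x y) : mk q x = mk q y :=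
  RingQuot.mkAlgHom_rel k h

theorem D1_mul_D2 (q : kˣ) : D1 q * D2 q = D2 q * D1 q := by
  simpa only [map_mul, D1, D2, sig, sigInv, gen] using mk_rel (HqRel.comm (q := q))

theorem sig_mul_sigInv (q : kˣ) : sig q * sigInv q = 1 := by
  simpa only [map_mul, map_one, D1, D2, sig, sigInv, gen] using mk_rel (HqRel.sig_mul_inv (q := q))

theorem sigInv_mul_sig (q : kˣ) : sigInv q * sig q = 1 := by
  simpa only [map_mul, map_one, D1, D2, sig, sigInv, gen] using mk_rel (HqRel.inv_mul_sig (q := q))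

theorem sig_mul_D1 (q : kˣ) : (q : k) • (sig q * D1 q) = D1 q * sig q := by
  simpa only [map_mul, map_smul, D1, D2, sig, sigInv, gen] using mk_rel (HqRel.sig_D1 (q := q))

theorem sig_mul_D2 (q : kˣ) : (q : k) • (sig q * D2 q) = D2 q * sig q := by
  simpa only [map_mul, map_smul, D1, D2, sig, sigInv, gen] using mk_rel (HqRel.sig_D2 (q := q))

theorem D1_pow (q : kˣ) {l : ℕ} (hl : 2 ≤ l) (hq : IsPrimitiveRoot (q : k) l) :
    D1 q ^ l = 0 := by
  simpa only [map_pow, map_zero, D1, D2, sig, sigInv, gen] using mk_rel (HqRel.D1_pow l hl hq)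

theorem D2_pow (q : kˣ) {l : ℕ} (hl : 2 ≤ l) (hq : IsPrimitiveRoot (q : k) l) :
    D2 q ^ l = 0 := by
  simpa only [map_pow, map_zero, D1, D2, sig, sigInv, gen] using mk_rel (HqRel.D2_pow l hl hq)

section Lift

variable {B : Type*} [Ring B] [Algebra k B]

/-- The images `d1, d2, s, t` of the generators, as a function on `Gen`. -/
def genFun (d1 d2 s t : B) : Gen → B
  | Gen.D1 => d1
  | Gen.D2 => d2
  | Gen.sig => s
  | Gen.sigInv => t

/-- The universal property of `H_q`. -/
noncomputable def lift (q : kˣ) (d1 d2 s t : B) (hc : d1 * d2 = d2 * d1) (hst : s * t = 1)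
    (hts : t * s = 1) (h1 : (q : k) • (s * d1) = d1 * s) (h2 : (q : k) • (s * d2) = d2 * s)
    (hp1 : ∀ l, 2 ≤ l → IsPrimitiveRoot (q : k) l → d1 ^ l = 0)
    (hp2 : ∀ l, 2 ≤ l → IsPrimitiveRoot (q : k) l → d2 ^ l = 0) : Hq q →ₐ[k] B :=
  RingQuot.liftAlgHom k ⟨FreeAlgebra.lift k (genFun d1 d2 s t), by
    intro x y h
    induction h with
    | comm => simpa [genFun] using hc
    | sig_mul_inv => simpa [genFun] using hst
    | inv_mul_sig => simpa [genFun] using hts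
    | sig_D1 => simpa [genFun] using h1
    | sig_D2 => simpa [genFun] using h2
    | D1_pow l hl hq => simpa [genFun] using hp1 l hl hq
    | D2_pow l hl hq => simpa [genFun] using hp2 l hl hq⟩

theorem lift_gen (q : kˣ) (d1 d2 s t : B) (hc hst hts h1 h2 hp1 hp2) (x : Gen) :
    lift q d1 d2 s t hc hst hts h1 h2 hp1 hp2 (gen q x) = genFun d1 d2 s t x := by
  unfold lift gen mk
  exact (RingQuot.liftAlgHom_mkAlgHom_apply k _ _ _).trans (FreeAlgebra.lift_ι_apply _ _)

theorem algHom_ext {q : kˣ} {f g : Hq q →ₐ[k] B} (h : ∀ x, f (gen q x) = g (gen q x)) :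
    f = g := by
  refine RingQuot.ringQuot_ext' k _ _ (FreeAlgebra.hom_ext ?_)
  funext x
  exact h x

end Lift

/-- The comultiplication: `Δ(D_1) = D_1 ⊗ σ + 1 ⊗ D_1`, `Δ(D_2) = D_2 ⊗ 1 + σ ⊗ D_2`,
`Δ(σ) = σ ⊗ σ`. -/
noncomputable def comulHom (q : kˣ) : Hq q →ₐ[k] Hq q ⊗[k] Hq q :=
  lift q (D1 q ⊗ₜ sig q + 1 ⊗ₜ D1 q) (D2 q ⊗ₜ 1 + sig q ⊗ₜ D2 q) (sig q ⊗ₜ sig q)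
    (sigInv q ⊗ₜ sigInv q)
    (by
      simp only [add_mul, mul_add, Algebra.TensorProduct.tmul_mul_tmul, one_mul, mul_one]
      rw [D1_mul_D2, ← sig_mul_D1, ← sig_mul_D2]
      simp only [TensorProduct.smul_tmul', TensorProduct.tmul_smul]
      abel)
    (by simp [sig_mul_sigInv, Algebra.TensorProduct.one_def])
    (by simp [sigInv_mul_sig, Algebra.TensorProduct.one_def])
    (by
      simp only [add_mul, mul_add, Algebra.TensorProduct.tmul_mul_tmul, one_mul, mul_one, smul_add]
      rw [← sig_mul_D1]
      simp only [TensorProduct.smul_tmul', TensorProduct.tmul_smul])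
    (by
      simp only [add_mul, mul_add, Algebra.TensorProduct.tmul_mul_tmul, one_mul, mul_one, smul_add]
      rw [← sig_mul_D2]
      simp only [TensorProduct.smul_tmul', TensorProduct.tmul_smul])
    (by
      intro l hl hq
      rw [add_pow_of_qcomm_primitive hl hq]
      · simp [Algebra.TensorProduct.tmul_pow, D1_pow q hl hq]
      · simp only [Algebra.TensorProduct.tmul_mul_tmul, one_mul, mul_one]
        rw [← sig_mul_D1, TensorProduct.tmul_smul])
    (by
      intro l hl hq
      rw [add_comm, add_pow_of_qcomm_primitive hl hq]
      · simp [Algebra.TensorProduct.tmul_pow, D2_pow q hl hq]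
      · simp only [Algebra.TensorProduct.tmul_mul_tmul, one_mul, mul_one]
        rw [← sig_mul_D2, TensorProduct.smul_tmul'])

/-- The counit: `ε(D_1) = ε(D_2) = 0`, `ε(σ) = 1`. -/
noncomputable def counitHom (q : kˣ) : Hq q →ₐ[k] k :=
  lift q 0 0 1 1 (by simp) (by simp) (by simp) (by simp) (by simp)
    (fun l hl _ => zero_pow (by omega)) (fun l hl _ => zero_pow (by omega))

theorem comulHom_D1 (q : kˣ) : comulHom q (D1 q) = D1 q ⊗ₜ sig q + 1 ⊗ₜ D1 q :=
  lift_gen ..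

theorem comulHom_D2 (q : kˣ) : comulHom q (D2 q) = D2 q ⊗ₜ 1 + sig q ⊗ₜ D2 q :=
  lift_gen ..

theorem comulHom_sig (q : kˣ) : comulHom q (sig q) = sig q ⊗ₜ sig q :=
  lift_gen ..

theorem comulHom_sigInv (q : kˣ) : comulHom q (sigInv q) = sigInv q ⊗ₜ sigInv q :=
  lift_gen ..

theorem counitHom_D1 (q : kˣ) : counitHom q (D1 q) = 0 :=
  lift_gen ..

theorem counitHom_D2 (q : kˣ) : counitHom q (D2 q) = 0 :=
  lift_gen ..

theorem counitHom_sig (q : kˣ) : counitHom q (sig q) = 1 :=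
  lift_gen ..

theorem counitHom_sigInv (q : kˣ) : counitHom q (sigInv q) = 1 :=
  lift_gen ..

theorem algHom_ext4 {q : kˣ} {B : Type*} [Ring B] [Algebra k B] {f g : Hq q →ₐ[k] B}
    (h1 : f (D1 q) = g (D1 q)) (h2 : f (D2 q) = g (D2 q)) (h3 : f (sig q) = g (sig q))
    (h4 : f (sigInv q) = g (sigInv q)) : f = g :=
  algHom_ext fun x => match x with
    | Gen.D1 => h1
    | Gen.D2 => h2
    | Gen.sig => h3
    | Gen.sigInv => h4

noncomputable instance instBialgebra (q : kˣ) : Bialgebra k (Hq q) :=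
  Bialgebra.ofAlgHom (comulHom q) (counitHom q)
    (by
      apply algHom_ext4 <;>
        simp [comulHom_D1, comulHom_D2, comulHom_sig, comulHom_sigInv, TensorProduct.add_tmul,
          TensorProduct.tmul_add, Algebra.TensorProduct.one_def, add_assoc])
    (by
      apply algHom_ext4 <;>
        simp [comulHom_D1, comulHom_D2, comulHom_sig, comulHom_sigInv, counitHom_D1,
          counitHom_D2, counitHom_sig, counitHom_sigInv])
    (by
      apply algHom_ext4 <;>
        simp [comulHom_D1, comulHom_D2, comulHom_sig, comulHom_sigInv, counitHom_D1,
          counitHom_D2, counitHom_sig, counitHom_sigInv])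

end Hq

end Hq

/-! ### Crossed products `S(V) #_f G` -/

section Crossed

/-- A normal (normalized) 2-cocycle of `G` with values in `k^×`, where `G` acts trivially
on `k^×`. -/
structure NormalCocycle (G k : Type*) [Group G] [Field k] where
  /-- The underlying function. -/
  toFun : G → G → kˣ
  one_left : ∀ g, toFun 1 g = 1
  one_right : ∀ g, toFun g 1 = 1
  cocycle : ∀ g h l, toFun g h * toFun (g * h) l = toFun h l * toFun g (h * l)

variable {k G V : Type*} [Field k] [Group G] [AddCommGroup V] [Module k V]

/-- The action of `g ∈ G` on `S(V)` by the algebra morphism extending its action on `V`. -/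
noncomputable def symAct (r : Representation k G V) (g : G) :
    SymmetricAlgebra k V →ₐ[k] SymmetricAlgebra k V :=
  SymmetricAlgebra.lift (SymmetricAlgebra.ι k V ∘ₗ r g)

theorem symAct_one (r : Representation k G V) (P : SymmetricAlgebra k V) :
    symAct r 1 P = P := by
  have h : symAct r 1 = AlgHom.id k _ := by
    apply SymmetricAlgebra.algHom_ext
    ext v
    simp [symAct]
  rw [h, AlgHom.id_apply]

theorem symAct_mul (r : Representation k G V) (g h : G) (P : SymmetricAlgebra k V) :
    symAct r (g * h) P = symAct r g (symAct r h P) := by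
  have h : symAct r (g * h) = (symAct r g).comp (symAct r h) := by
    apply SymmetricAlgebra.algHom_ext
    ext v
    simp [symAct]
  rw [h, AlgHom.comp_apply]

/-- The crossed product `S(V) #_f G`: the free left `S(V)`-module on the symbols `w_g`, `g ∈ G`.
The finitely supported function `a` stands for `∑ g, a(g) w_g`. -/
def Crossed (r : Representation k G V) (f : NormalCocycle G k) : Type _ :=
  let _ := r
  let _ := f
  G →₀ SymmetricAlgebra k V

namespace Crossed

variable (r : Representation k G V) (f : NormalCocycle G k)

noncomputable instance : AddCommGroup (Crossed r f) :=
  inferInstanceAs (AddCommGroup (G →₀ SymmetricAlgebra k V))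

noncomputable instance : Module k (Crossed r f) :=
  inferInstanceAs (Module k (G →₀ SymmetricAlgebra k V))

/-- The element `P w_g` of `S(V) #_f G`. -/
noncomputable def term (g : G) (P : SymmetricAlgebra k V) : Crossed r f :=
  Finsupp.single g P

/-- The product, `(P w_g) (Q w_h) = P (g • Q) f(g, h) w_{gh}`, extended biadditively. -/
noncomputable instance : Mul (Crossed r f) where
  mul a b := Finsupp.sum a fun g P => Finsupp.sum b fun h Q =>
    term r f (g * h) ((f.toFun g h : k) • (P * symAct r g Q))

noncomputable instance : One (Crossed r f) where
  one := term r f 1 1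

variable {r f}

theorem mul_def (a b : Crossed r f) : a * b =
    Finsupp.sum a fun g P => Finsupp.sum b fun h Q =>
      term r f (g * h) ((f.toFun g h : k) • (P * symAct r g Q)) := rfl

theorem one_def : (1 : Crossed r f) = term r f 1 1 := rfl

theorem term_zero (g : G) : term r f g 0 = 0 := Finsupp.single_zero g

theorem term_add (g : G) (P Q : SymmetricAlgebra k V) :
    term r f g (P + Q) = term r f g P + term r f g Q := Finsupp.single_add g P Q

theorem smul_term (c : k) (g : G) (P : SymmetricAlgebra k V) :
    c • term r f g P = term r f g (c • P) := Finsupp.smul_single c g P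

theorem term_mul_term (g h : G) (P Q : SymmetricAlgebra k V) :
    term r f g P * term r f h Q =
      term r f (g * h) ((f.toFun g h : k) • (P * symAct r g Q)) := by
  rw [mul_def, term, term, Finsupp.sum_single_index, Finsupp.sum_single_index]
  · simp [term_zero]
  · rw [Finsupp.sum_single_index] <;> simp [term_zero]

@[elab_as_elim]
theorem induction {p : Crossed r f → Prop} (a : Crossed r f) (h0 : p 0)
    (hadd : ∀ a b, p a → p b → p (a + b)) (hterm : ∀ g P, p (term r f g P)) : p a :=
  Finsupp.induction_linear a h0 hadd hterm

theorem add_mul' (a b c : Crossed r f) : (a + b) * c = a * c + b * c := by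
  rw [mul_def]
  refine Finsupp.sum_add_index' (fun g => ?_) (fun g P Q => ?_)
  · simp [term_zero, Finsupp.sum]
  · simp only [add_mul, smul_add, term_add]
    exact Finsupp.sum_add

theorem mul_add' (a b c : Crossed r f) : a * (b + c) = a * b + a * c := by
  rw [mul_def, mul_def, mul_def]
  refine (Finsupp.sum_congr fun g _ => ?_).trans Finsupp.sum_add
  refine Finsupp.sum_add_index' (fun h => ?_) (fun h P Q => ?_)
  · simp [term_zero]
  · simp only [map_add, mul_add, smul_add, term_add]

theorem zero_mul' (a : Crossed r f) : 0 * a = 0 := Finsupp.sum_zero_index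

theorem mul_zero' (a : Crossed r f) : a * 0 = 0 := by
  have h := mul_add' a 0 0
  rw [add_zero] at h
  exact left_eq_add.mp h

theorem mul_assoc' (a b c : Crossed r f) : a * b * c = a * (b * c) := by
  induction a using Crossed.induction with
  | h0 => simp only [zero_mul']
  | hadd a a' ha ha' => simp only [add_mul', ha, ha']
  | hterm g P =>
    induction b using Crossed.induction with
    | h0 => simp only [zero_mul', mul_zero']
    | hadd b b' hb hb' => simp only [add_mul', mul_add', hb, hb']
    | hterm h Q =>
      induction c using Crossed.induction with
      | h0 => simp only [mul_zero']
      | hadd c c' hc hc' => simp only [mul_add', hc, hc']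
      | hterm l S =>
        have hf : (f.toFun g h : k) * f.toFun (g * h) l = f.toFun h l * f.toFun g (h * l) := by
          exact_mod_cast congrArg Units.val (f.cocycle g h l)
        simp only [term_mul_term, symAct_mul, map_smul, map_mul, mul_smul_comm, smul_mul_assoc,
          smul_smul, mul_assoc]
        rw [mul_comm (f.toFun (g * h) l : k), hf, mul_comm (f.toFun h l : k)]

theorem one_mul' (a : Crossed r f) : 1 * a = a := by
  induction a using Crossed.induction with
  | h0 => exact mul_zero' _
  | hadd a a' ha ha' => rw [mul_add', ha, ha']
  | hterm g P => simp [one_def, term_mul_term, f.one_left, symAct_one]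

theorem mul_one' (a : Crossed r f) : a * 1 = a := by
  induction a using Crossed.induction with
  | h0 => exact zero_mul' _
  | hadd a a' ha ha' => rw [add_mul', ha, ha']
  | hterm g P => simp [one_def, term_mul_term, f.one_right]

variable (r f)

noncomputable instance : Ring (Crossed r f) where
  __ := (inferInstance : AddCommGroup (Crossed r f))
  __ := (inferInstance : Mul (Crossed r f))
  __ := (inferInstance : One (Crossed r f))
  mul_assoc := mul_assoc'
  one_mul := one_mul'
  mul_one := mul_one'
  left_distrib := mul_add'
  right_distrib := add_mul'
  zero_mul := zero_mul'
  mul_zero := mul_zero'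

theorem smul_mul' (c : k) (a b : Crossed r f) : c • a * b = c • (a * b) := by
  induction a using Crossed.induction with
  | h0 => simp only [smul_zero, zero_mul]
  | hadd a a' ha ha' => simp only [smul_add, add_mul, ha, ha']
  | hterm g P =>
    induction b using Crossed.induction with
    | h0 => simp only [smul_zero, mul_zero]
    | hadd b b' hb hb' => simp only [smul_add, mul_add, hb, hb']
    | hterm h Q =>
      simp only [smul_term, term_mul_term, smul_mul_assoc]
      rw [smul_comm]

theorem mul_smul' (c : k) (a b : Crossed r f) : a * c • b = c • (a * b) := by
  induction a using Crossed.induction with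
  | h0 => simp only [smul_zero, zero_mul]
  | hadd a a' ha ha' => simp only [smul_add, add_mul, ha, ha']
  | hterm g P =>
    induction b using Crossed.induction with
    | h0 => simp only [smul_zero, mul_zero]
    | hadd b b' hb hb' => simp only [smul_add, mul_add, hb, hb']
    | hterm h Q =>
      simp only [smul_term, term_mul_term, map_smul, mul_smul_comm]
      rw [smul_comm]

noncomputable instance : Algebra k (Crossed r f) :=
  Algebra.ofModule (smul_mul' r f) (mul_smul' r f)

/-- The basis element `w_g`. -/
noncomputable def w (g : G) : Crossed r f := term r f g 1

/-- A vector `v ∈ V`, as the element `v w_1` of `S(V) #_f G`. -/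
noncomputable def ofV (v : V) : Crossed r f := term r f 1 (SymmetricAlgebra.ι k V v)

end Crossed

/-- `S(U)` as a subalgebra of `S(V)`, for a subspace `U` of `V`. -/
noncomputable def symSub (U : Submodule k V) : Subalgebra k (SymmetricAlgebra k V) :=
  (SymmetricAlgebra.lift (SymmetricAlgebra.ι k V ∘ₗ U.subtype)).range

end Crossed

/-! ### Transpositions and braided module algebras

`H` is an ordinary bialgebra, considered as a braided bialgebra whose braid is the flip. -/

section Braided

variable {k H A : Type*} [Field k] [Ring H] [Bialgebra k H] [Ring A] [Algebra k A]

/-- `(s ⊗ H) ∘ (H ⊗ s) : H ⊗ H ⊗ A → A ⊗ H ⊗ H`. -/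
noncomputable def braidHH (s : H ⊗[k] A →ₗ[k] A ⊗[k] H) :
    H ⊗[k] (H ⊗[k] A) →ₗ[k] A ⊗[k] (H ⊗[k] H) :=
  (TensorProduct.assoc k A H H).toLinearMap ∘ₗ s.rTensor H ∘ₗ
    (TensorProduct.assoc k H A H).symm.toLinearMap ∘ₗ s.lTensor H

/-- `(A ⊗ s) ∘ (s ⊗ A) : H ⊗ A ⊗ A → A ⊗ A ⊗ H`. -/
noncomputable def braidAA (s : H ⊗[k] A →ₗ[k] A ⊗[k] H) :
    (H ⊗[k] A) ⊗[k] A →ₗ[k] A ⊗[k] (A ⊗[k] H) :=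
  s.lTensor A ∘ₗ (TensorProduct.assoc k A H A).toLinearMap ∘ₗ s.rTensor A

/-- `c ⊗ A : H ⊗ H ⊗ A → H ⊗ H ⊗ A`, where `c` is the flip of `H ⊗ H`. -/
noncomputable def flipHH : H ⊗[k] (H ⊗[k] A) →ₗ[k] H ⊗[k] (H ⊗[k] A) :=
  (TensorProduct.leftComm k H H A).toLinearMap

/-- A left transposition of `H` on `A`: a bijective linear map `s : H ⊗ A → A ⊗ H` compatible
with the algebra structure, the coalgebra structure and the braid (the flip) of `H`, and with the
algebra structure of `A`. -/
structure IsTransposition (s : H ⊗[k] A →ₗ[k] A ⊗[k] H) : Prop where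
  bijective : Function.Bijective s
  /-- `s ∘ (η ⊗ A) = A ⊗ η`. -/
  one_tmul : ∀ a : A, s (1 ⊗ₜ a) = a ⊗ₜ 1
  /-- `s ∘ (μ ⊗ A) = (A ⊗ μ) ∘ (s ⊗ H) ∘ (H ⊗ s)`. -/
  mul_tmul : ∀ (h l : H) (a : A),
    s ((h * l) ⊗ₜ a) = (LinearMap.mul' k H).lTensor A (braidHH s (h ⊗ₜ (l ⊗ₜ a)))
  /-- `(A ⊗ ε) ∘ s = ε ⊗ A`. -/
  counit_comp : ∀ (h : H) (a : A),
    TensorProduct.rid k A ((Coalgebra.counit (R := k) (A := H)).lTensor A (s (h ⊗ₜ a))) =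
      Coalgebra.counit (R := k) h • a
  /-- `(A ⊗ Δ) ∘ s = (s ⊗ H) ∘ (H ⊗ s) ∘ (Δ ⊗ A)`. -/
  comul_comp : ∀ (h : H) (a : A),
    (Coalgebra.comul (R := k) (A := H)).lTensor A (s (h ⊗ₜ a)) =
      braidHH s (TensorProduct.assoc k H H A (Coalgebra.comul (R := k) h ⊗ₜ a))
  /-- `(s ⊗ H) ∘ (H ⊗ s) ∘ (c ⊗ A) = (A ⊗ c) ∘ (s ⊗ H) ∘ (H ⊗ s)`. -/
  braid_comp : ∀ x : H ⊗[k] (H ⊗[k] A),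
    braidHH s (flipHH x) = (TensorProduct.comm k H H).toLinearMap.lTensor A (braidHH s x)
  /-- `s ∘ (H ⊗ η) = η ⊗ H`. -/
  tmul_one : ∀ h : H, s (h ⊗ₜ 1) = 1 ⊗ₜ h
  /-- `s ∘ (H ⊗ μ) = (μ ⊗ H) ∘ (A ⊗ s) ∘ (s ⊗ A)`. -/
  tmul_mul : ∀ (h : H) (a b : A),
    s (h ⊗ₜ (a * b)) = (LinearMap.mul' k A).rTensor H
      ((TensorProduct.assoc k A A H).symm (braidAA s ((h ⊗ₜ a) ⊗ₜ b)))

/-- The linear map `H ⊗ A → A`, `h ⊗ a ↦ h · a`, of a left `H`-module structure on `A`; the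
latter is given as an algebra morphism from `H` to the linear endomorphisms of `A`. -/
noncomputable def actMap (ρ : H →ₐ[k] Module.End k A) : H ⊗[k] A →ₗ[k] A :=
  TensorProduct.lift ρ.toLinearMap

/-- The composition `(ρ ⊗ ρ) ∘ (H ⊗ s ⊗ A) ∘ (Δ ⊗ A ⊗ A)`, as the value at `h ⊗ a ⊗ b`. -/
noncomputable def diagAct (s : H ⊗[k] A →ₗ[k] A ⊗[k] H) (ρ : H →ₐ[k] Module.End k A)
    (h : H) (a b : A) : A ⊗[k] A :=
  TensorProduct.map (actMap ρ) (actMap ρ)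
    ((TensorProduct.assoc k (H ⊗[k] A) H A)
      (((TensorProduct.assoc k H A H).symm.toLinearMap ∘ₗ s.lTensor H ∘ₗ
        (TensorProduct.assoc k H H A).toLinearMap).rTensor A
          ((Coalgebra.comul (R := k) h ⊗ₜ a) ⊗ₜ b)))

/-- `(A, s)` is a left `H`-module algebra via the (ordinary) left `H`-module structure `ρ`. -/
structure IsModuleAlgebra (s : H ⊗[k] A →ₗ[k] A ⊗[k] H) (ρ : H →ₐ[k] Module.End k A) :
    Prop where
  transposition : IsTransposition s
  /-- `s ∘ (H ⊗ ρ) = (ρ ⊗ H) ∘ (H ⊗ s) ∘ (c ⊗ A)`. -/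
  braided : ∀ x : H ⊗[k] (H ⊗[k] A),
    s ((actMap ρ).lTensor H x) = (actMap ρ).rTensor H
      ((TensorProduct.assoc k H A H).symm (s.lTensor H (flipHH x)))
  /-- `μ ∘ (ρ ⊗ ρ) ∘ (H ⊗ s ⊗ A) ∘ (Δ ⊗ A ⊗ A) = ρ ∘ (H ⊗ μ)`. -/
  map_mul : ∀ (h : H) (a b : A), ρ h (a * b) = LinearMap.mul' k A (diagAct s ρ h a b)
  /-- `h · 1 = ε(h) 1`. -/
  map_one : ∀ h : H, ρ h 1 = Coalgebra.counit (R := k) h • (1 : A)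

end Braided

/-- A linear map `s : H_q ⊗ A → A ⊗ H_q` is good if
`(s ⊗ H_q) ((H_q ⊗ s) (D_1 ⊗ D_2 ⊗ a)) = a ⊗ D_1 ⊗ D_2` for all `a`. -/
def IsGood {k A : Type*} [Field k] [Ring A] [Algebra k A] {q : kˣ}
    (s : Hq q ⊗[k] A →ₗ[k] A ⊗[k] Hq q) : Prop :=
  ∀ a : A, braidHH s (Hq.D1 q ⊗ₜ (Hq.D2 q ⊗ₜ a)) = a ⊗ₜ (Hq.D1 q ⊗ₜ Hq.D2 q)

end BraidedHq

/-! Write $A=S(V)\#_fG$. The transposition is diagonal on all the generators used: $s(D_1\otimes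
a)=\alpha(a)\otimes D_1$ with $\alpha$ an automorphism of $A$. Compatibility with $\Delta(D_1)$ then
forces $s(\sigma\otimes a)=a\otimes\sigma$, and goodness forces $s(D_2\otimes
a)=\alpha^{-1}(a)\otimes D_2$. So $\sigma$ acts by an algebra endomorphism $\varsigma$, and $D_1$,
$D_2$ act by skew derivations $\delta(xy)=\delta(x)b(y)+c(x)\delta(y)$, with
$(b,c)=(\varsigma,\alpha)$ and $(\mathrm{id},\varsigma\alpha^{-1})$ respectively.

Two relations of $A$ are differentiated. From $xv=vx$ with $\delta(v)=0$: if $w_g$ occurs in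
$\delta(x)$, then $gb=c$ on $\ker\delta$ (`skewDer_eq_on_ker`). From $w_gx={}^gx\,w_g$, with the
coefficient of $w_g$ in $\delta(x)$ lying in $S(\ker\delta)$: $\lambda B=C$, where $\lambda$, $B$,
$C$ are the scalars by which $g$ acts on $x$ modulo $\ker\delta$ and $b$, $c$ act on $\delta(x)$
(`skewDer_eigenvalue`).

Let $a_i$, $s_i$ be the scalars of $\hat\alpha$, $\hat\varsigma$ on $V/\ker\hat\delta_i$. By
$q\sigma D_i=D_i\sigma$, $\varsigma$ scales $\hat\delta_i(x_i)$ by $q^{-1}s_i$. With $g=g_{1j}$,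
$g'=g_{2h}$ this yields $\lambda_{1g}q^{-1}s_1=a_1$ and $\lambda_{2g'}=a_2^{-1}q^{-1}s_2$, while the
identities on kernels yield $a_1\lambda_{1g'}=s_1$ and $s_2\lambda_{2g}=a_2$; multiply. Moreover
$gg'$ fixes $\ker\hat\delta_1\cap\ker\hat\delta_2$ pointwise, so its determinant is $q\cdot q^{-1}$
(`det_eq_mul_of_trivial_on_inf`). -/

namespace BraidedHq

/-! ### Diagonal endomorphisms and coefficients of the crossed product -/

section DiagonalMaps

variable {k G V : Type*} [Field k] [Group G] [AddCommGroup V] [Module k V]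

/-- The algebra endomorphism of `S(V)` extending a linear endomorphism of `V`. -/
noncomputable def symMap (e : V →ₗ[k] V) : SymmetricAlgebra k V →ₐ[k] SymmetricAlgebra k V :=
  SymmetricAlgebra.lift (SymmetricAlgebra.ι k V ∘ₗ e)

@[simp]
theorem symMap_ι (e : V →ₗ[k] V) (v : V) :
    symMap e (SymmetricAlgebra.ι k V v) = SymmetricAlgebra.ι k V (e v) := by
  simp [symMap]

theorem symMap_id (P : SymmetricAlgebra k V) : symMap LinearMap.id P = P := by
  have h : symMap (LinearMap.id : V →ₗ[k] V) = AlgHom.id k _ := by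
    apply SymmetricAlgebra.algHom_ext
    ext v
    simp
  rw [h, AlgHom.id_apply]

theorem symMap_symMap (e e' : V →ₗ[k] V) (P : SymmetricAlgebra k V) :
    symMap e (symMap e' P) = symMap (e ∘ₗ e') P := by
  have h : (symMap e).comp (symMap e') = symMap (e ∘ₗ e') := by
    apply SymmetricAlgebra.algHom_ext
    ext v
    simp
  rw [← h, AlgHom.comp_apply]

theorem symAct_eq_symMap (r : Representation k G V) (g : G) : symAct r g = symMap (r g) := rfl

/-- Both maps are algebra morphisms, and $S(U)$ is generated by $U$. This carries an identity valid
only on $\ker\delta$ over to the coefficients of $\delta(x)$. -/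
theorem symMap_eq_of_mem_symSub {U : Submodule k V} {e e' : V →ₗ[k] V}
    (h : ∀ u ∈ U, e u = e' u) {P : SymmetricAlgebra k V} (hP : P ∈ symSub U) :
    symMap e P = symMap e' P := by
  obtain ⟨Q, rfl⟩ := hP
  have : (symMap e).comp (SymmetricAlgebra.lift (SymmetricAlgebra.ι k V ∘ₗ U.subtype)) =
      (symMap e').comp (SymmetricAlgebra.lift (SymmetricAlgebra.ι k V ∘ₗ U.subtype)) := by
    apply SymmetricAlgebra.algHom_ext
    ext u
    simp [h u u.2]
  exact DFunLike.congr_fun this Q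

/-- Each coordinate form of a basis extends to an algebra morphism $S(V)\to k$, which recovers that
coordinate of $v$ from its image. -/
theorem ι_injective : Function.Injective (SymmetricAlgebra.ι k V) := by
  intro v w h
  have b := Module.Free.chooseBasis k V
  apply b.repr.injective
  ext i
  have h2 := congrArg (SymmetricAlgebra.lift (A := k) (b.coord i)) h
  simpa using h2

namespace Crossed

variable {r : Representation k G V} {f : NormalCocycle G k}

variable (r f) in
/-- The coefficient of `w_g`. -/
noncomputable def coeff (g : G) : Crossed r f →ₗ[k] SymmetricAlgebra k V :=
  (Finsupp.lapply g : (G →₀ SymmetricAlgebra k V) →ₗ[k] SymmetricAlgebra k V)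

theorem coeff_term_self (g : G) (P : SymmetricAlgebra k V) :
    coeff r f g (term r f g P) = P := Finsupp.single_eq_same

theorem coeff_term_of_ne {g h : G} (hgh : h ≠ g) (P : SymmetricAlgebra k V) :
    coeff r f g (term r f h P) = 0 := Finsupp.single_eq_of_ne' hgh

theorem coeff_sum_term {ι : Type*} [Fintype ι] {g : ι → G} (hg : Function.Injective g)
    (P : ι → SymmetricAlgebra k V) (j : ι) :
    coeff r f (g j) (∑ i, term r f (g i) (P i)) = P j := by
  rw [map_sum, Finset.sum_eq_single j, coeff_term_self]
  · exact fun i _ hij => coeff_term_of_ne (hg.ne hij) _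
  · simp

/-- Left translation by $h$ is injective on $G$, so only the $w_g$-term of $a$ contributes to
$w_{hg}$. -/
theorem coeff_term_mul_term_mul (g h : G) (P : SymmetricAlgebra k V) (a : Crossed r f) :
    coeff r f (h * g) (term r f h P * a) =
      (f.toFun h g : k) • (P * symAct r h (coeff r f g a)) := by
  induction a using Crossed.induction with
  | h0 => simp
  | hadd a b ha hb => simp only [mul_add, map_add, ha, hb, smul_add]
  | hterm l Q =>
    rw [term_mul_term]
    by_cases hl : l = g
    · subst hl
      rw [coeff_term_self, coeff_term_self]
    · rw [coeff_term_of_ne hl, coeff_term_of_ne (by simpa using hl)]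
      simp

theorem coeff_mul_term (g h : G) (P : SymmetricAlgebra k V) (a : Crossed r f) :
    coeff r f (g * h) (a * term r f h P) =
      (f.toFun g h : k) • (coeff r f g a * symAct r g P) := by
  induction a using Crossed.induction with
  | h0 => simp
  | hadd a b ha hb => simp only [add_mul, map_add, ha, hb, smul_add]
  | hterm l Q =>
    rw [term_mul_term]
    by_cases hl : l = g
    · subst hl
      rw [coeff_term_self, coeff_term_self]
    · rw [coeff_term_of_ne hl, coeff_term_of_ne (by simpa using hl)]
      simp

theorem ofV_mul_ofV_comm (v v' : V) : ofV r f v * ofV r f v' = ofV r f v' * ofV r f v := by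
  simp only [ofV, term_mul_term, symAct_one, mul_comm]

theorem w_mul_ofV (g : G) (v : V) : w r f g * ofV r f v = ofV r f (r g v) * w r f g := by
  simp [w, ofV, term_mul_term, f.one_left, f.one_right, symAct_eq_symMap]

theorem term_one_mul_term_one (P Q : SymmetricAlgebra k V) :
    term r f 1 (P * Q) = term r f 1 P * term r f 1 Q := by
  simp [term_mul_term, f.one_left, symAct_one]

theorem term_one_mul_w (g : G) (P : SymmetricAlgebra k V) :
    term r f 1 P * w r f g = term r f g P := by
  simp [w, term_mul_term, f.one_left]

theorem term_one_algebraMap (c : k) :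
    term r f 1 (algebraMap k (SymmetricAlgebra k V) c) = c • 1 := by
  rw [one_def, smul_term, Algebra.algebraMap_eq_smul_one]

variable (r f) in
/-- The linear endomorphism `P w_g ↦ c(g) e(P) w_g` of `S(V) #_f G`. -/
noncomputable def diagMap (e : V →ₗ[k] V) (c : G → k) : Crossed r f →ₗ[k] Crossed r f :=
  show (G →₀ SymmetricAlgebra k V) →ₗ[k] (G →₀ SymmetricAlgebra k V) from
    Finsupp.lsum k fun g => Finsupp.lsingle g ∘ₗ (c g • (symMap e).toLinearMap)

theorem diagMap_term (e : V →ₗ[k] V) (c : G → k) (g : G) (P : SymmetricAlgebra k V) :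
    diagMap r f e c (term r f g P) = c g • term r f g (symMap e P) := by
  rw [smul_term]
  exact Finsupp.sum_single_index (h := fun g P => Finsupp.single g (c g • symMap e P)) (by simp)

theorem diagMap_w (e : V →ₗ[k] V) (c : G → k) (g : G) :
    diagMap r f e c (w r f g) = c g • w r f g := by
  rw [w, diagMap_term, map_one]

theorem diagMap_ofV (e : V →ₗ[k] V) (c : G → k) (hc : c 1 = 1) (v : V) :
    diagMap r f e c (ofV r f v) = ofV r f (e v) := by
  rw [ofV, diagMap_term, hc, one_smul, symMap_ι, ofV]

theorem coeff_diagMap (e : V →ₗ[k] V) (c : G → k) (g : G) (a : Crossed r f) :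
    coeff r f g (diagMap r f e c a) = c g • symMap e (coeff r f g a) := by
  induction a using Crossed.induction with
  | h0 => simp
  | hadd a b ha hb => simp only [map_add, ha, hb, smul_add]
  | hterm l Q =>
    rw [diagMap_term, map_smul]
    by_cases hl : l = g
    · subst hl
      rw [coeff_term_self, coeff_term_self]
    · simp [coeff_term_of_ne hl]

theorem diagMap_diagMap (e e' : V →ₗ[k] V) (c c' : G → k) (a : Crossed r f) :
    diagMap r f e c (diagMap r f e' c' a) = diagMap r f (e ∘ₗ e') (fun g => c g * c' g) a := by
  induction a using Crossed.induction with
  | h0 => simp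
  | hadd a b ha hb => simp only [map_add, ha, hb]
  | hterm l Q =>
    rw [diagMap_term, map_smul, diagMap_term, diagMap_term, symMap_symMap, smul_smul, mul_comm]

theorem diagMap_id_one (a : Crossed r f) :
    diagMap r f LinearMap.id (fun _ => 1) a = a := by
  induction a using Crossed.induction with
  | h0 => simp
  | hadd a b ha hb => simp only [map_add, ha, hb]
  | hterm l Q => rw [diagMap_term, symMap_id, one_smul]

/-- A unital multiplicative linear map that is diagonal on generators is a `diagMap`. -/
theorem eq_diagMap (F : Crossed r f →ₗ[k] Crossed r f) (hone : F 1 = 1)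
    (hmul : ∀ a b, F (a * b) = F a * F b) (e : V →ₗ[k] V) (c : G → k)
    (hV : ∀ v, F (ofV r f v) = ofV r f (e v)) (hG : ∀ g, F (w r f g) = c g • w r f g) :
    F = diagMap r f e c := by
  -- $P\mapsto Pw_1$ is an algebra embedding, so $S(V)$ is handled by induction on polynomials; the
  -- general term is $(Pw_1)w_g$.
  have h1 : ∀ P, F (term r f 1 P) = term r f 1 (symMap e P) := by
    intro P
    induction P using SymmetricAlgebra.induction with
    | algebraMap t => rw [AlgHom.commutes, term_one_algebraMap, map_smul, hone]
    | ι v => rw [symMap_ι]; exact hV v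
    | mul P Q hP hQ => rw [map_mul, term_one_mul_term_one, hmul, hP, hQ, term_one_mul_term_one]
    | add P Q hP hQ => rw [map_add, term_add, map_add, hP, hQ, term_add]
  ext a
  induction a using Crossed.induction with
  | h0 => simp
  | hadd a b ha hb => simp only [map_add, ha, hb]
  | hterm g P =>
    rw [diagMap_term, ← term_one_mul_w, hmul, h1, hG, mul_smul', term_one_mul_w]

end Crossed

end DiagonalMaps

/-! ### Skew derivations of the crossed product -/

section TwistedDerivation

open Crossed

variable {k G V : Type*} [Field k] [Group G] [AddCommGroup V] [Module k V]
  {r : Representation k G V} {f : NormalCocycle G k}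
  {δ : Crossed r f →ₗ[k] Crossed r f} {b c : V →ₗ[k] V} {chib chic : G → k}

/-- A skew derivation of `S(V) #_f G`, killing the `w_g`, satisfies
`δ(ᵍv) χ_b(g) w_g = χ_c(g) w_g δ(v)`. -/
theorem skewDer_action
    (hδ : ∀ x y, δ (x * y) = δ x * diagMap r f b chib y + diagMap r f c chic x * δ y)
    (hδw : ∀ g, δ (w r f g) = 0) (g : G) (v : V) :
    chib g • (δ (ofV r f (r g v)) * w r f g) = chic g • (w r f g * δ (ofV r f v)) := by
  have h := congrArg δ (w_mul_ofV (r := r) (f := f) g v)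
  rw [hδ, hδ, hδw, zero_mul, mul_zero, zero_add, add_zero, diagMap_w, diagMap_w,
    Crossed.smul_mul', Crossed.mul_smul'] at h
  exact h.symm

theorem skewDer_ker
    (hδ : ∀ x y, δ (x * y) = δ x * diagMap r f b chib y + diagMap r f c chic x * δ y)
    (hδw : ∀ g, δ (w r f g) = 0) (hchib : ∀ g, chib g ≠ 0) (g : G) {v : V}
    (hv : δ (ofV r f v) = 0) : δ (ofV r f (r g v)) = 0 := by
  have h := skewDer_action hδ hδw g v
  rw [hv, mul_zero, smul_zero, smul_eq_zero, or_iff_right (hchib g)] at h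
  -- $w_g$ is a unit: $w_gw_{g^{-1}}$ is the nonzero scalar $f(g,g^{-1})$.
  have h2 := congrArg (· * w r f g⁻¹) h
  simp only [mul_assoc, zero_mul] at h2
  rw [w, w, term_mul_term, mul_inv_cancel, map_one, mul_one, ← smul_term, Crossed.mul_smul',
    ← one_def, mul_one] at h2
  exact (smul_eq_zero.mp h2).resolve_left (Units.ne_zero _)

/-- If `w_g` occurs in `δ(x)`, then `g b = c` on the kernel of `δ`. -/
theorem skewDer_eq_on_ker
    (hδ : ∀ x y, δ (x * y) = δ x * diagMap r f b chib y + diagMap r f c chic x * δ y)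
    (hchib : chib 1 = 1) (hchic : chic 1 = 1) {x : V} {g : G}
    (hP : coeff r f g (δ (ofV r f x)) ≠ 0) {v : V} (hv : δ (ofV r f v) = 0) :
    r g (b v) = c v := by
  have h := congrArg δ (ofV_mul_ofV_comm (r := r) (f := f) x v)
  rw [hδ, hδ, hv, zero_mul, mul_zero, zero_add, add_zero, diagMap_ofV _ _ hchib,
    diagMap_ofV _ _ hchic] at h
  -- Coefficients of $w_g$ are compared in $\delta(x)b(v)=c(v)\delta(x)$; writing $g$ as $g\cdot1$
  -- and $1\cdot g$ matches the two product formulas. The nonzero coefficient then cancels because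
  -- $S(V)$ is a domain.
  have h1 : coeff r f (g * 1) (δ (ofV r f x) * ofV r f (b v)) =
      coeff r f (1 * g) (ofV r f (c v) * δ (ofV r f x)) := by rw [h, mul_one, one_mul]
  rw [ofV.eq_1 r f (b v), ofV.eq_1 r f (c v), coeff_mul_term, coeff_term_mul_term_mul, f.one_left, f.one_right,
    symAct_one, Units.val_one, one_smul, one_smul, symAct_eq_symMap, symMap_ι,
    mul_comm (SymmetricAlgebra.ι k V (c v))] at h1
  exact ι_injective (mul_left_cancel₀ hP h1)

/-- With $P$ the coefficient of $w_g$ in $\delta(x)$, differentiating $w_gx={}^gx\,w_g$ gives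
$\chi_b(g)\lambda P=\chi_c(g)\,{}^gP$, while the eigenvector hypotheses give $\chi_b(g)b(P)=BP$ and
$\chi_c(g)c(P)=CP$. Since $P\in S(U)$ and $gb=c$ on $U$, also ${}^gb(P)=c(P)$; eliminating leaves
$\lambda B=C$. -/
theorem skewDer_eigenvalue
    (hδ : ∀ x y, δ (x * y) = δ x * diagMap r f b chib y + diagMap r f c chic x * δ y)
    (hδw : ∀ g, δ (w r f g) = 0) (hchib : chib 1 = 1) (hchic : chic 1 = 1)
    (hchib0 : ∀ g, chib g ≠ 0) {U : Submodule k V} (hU : ∀ v ∈ U, δ (ofV r f v) = 0)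
    {x : V} {g : G} (hP : coeff r f g (δ (ofV r f x)) ≠ 0)
    (hPU : coeff r f g (δ (ofV r f x)) ∈ symSub U) {B C lam : k}
    (hB : diagMap r f b chib (δ (ofV r f x)) = B • δ (ofV r f x))
    (hC : diagMap r f c chic (δ (ofV r f x)) = C • δ (ofV r f x))
    (hlam : δ (ofV r f (r g x)) = lam • δ (ofV r f x)) : lam * B = C := by
  -- At index $g\cdot g$ both sides see only $P$, with the same factor $f(g,g)$, which cancels.
  have h1 := congrArg (coeff r f (g * g)) (skewDer_action hδ hδw g x)
  rw [hlam, map_smul, map_smul, w, coeff_mul_term, coeff_term_mul_term_mul, smul_comm,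
    smul_comm (chic g), map_one, mul_one, one_mul] at h1
  replace h1 := smul_right_injective _ (Units.ne_zero (f.toFun g g)) h1
  rw [map_smul] at h1
  have hB' := congrArg (coeff r f g) hB
  have hC' := congrArg (coeff r f g) hC
  rw [coeff_diagMap, map_smul] at hB' hC'
  have h2 : symAct r g (symMap b (coeff r f g (δ (ofV r f x)))) =
      symMap c (coeff r f g (δ (ofV r f x))) := by
    rw [symAct_eq_symMap, symMap_symMap]
    exact symMap_eq_of_mem_symSub
      (fun u hu => skewDer_eq_on_ker hδ hchib hchic hP (hU u hu)) hPU
  set P := coeff r f g (δ (ofV r f x))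
  have h3 : (chib g * (lam * B)) • P = (chib g * C) • P := by
    calc (chib g * (lam * B)) • P = B • chib g • lam • P := by
          simp only [smul_smul]; congr 1; ring
      _ = chic g • symAct r g (B • P) := by rw [h1, map_smul, smul_comm]
      _ = chib g • chic g • symMap c P := by rw [← hB', map_smul, h2, smul_comm]
      _ = (chib g * C) • P := by rw [hC', smul_smul]
  exact mul_left_cancel₀ (hchib0 g) (smul_left_injective _ hP h3)

end TwistedDerivation

/-! ### Determinants along a flag of hyperplanes -/

section Determinant

variable {k V : Type*} [Field k] [AddCommGroup V] [Module k V] [FiniteDimensional k V]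

theorem exists_sub_smul_mem_of_finrank_quotient_eq_one {V : Type*} [AddCommGroup V] [Module k V]
    {W : Submodule k V} (hW : Module.finrank k (V ⧸ W) = 1) {x : V} (hx : x ∉ W) (v : V) :
    ∃ c : k, v - c • x ∈ W := by
  obtain ⟨c, hc⟩ := exists_smul_eq_of_finrank_eq_one hW
    (x := W.mkQ x) (by simpa using hx) (W.mkQ v)
  refine ⟨c, ?_⟩
  rw [← Submodule.Quotient.mk_eq_zero]
  simpa [sub_eq_zero] using hc.symm

/-- The determinant is multiplicative along $W\subset V$, and $T$ acts on the line $V/W$, spanned by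
the class of $x$, as the scalar $c$. -/
theorem det_eq_mul_det_restrict {W : Submodule k V} (hW : Module.finrank k (V ⧸ W) = 1)
    {x : V} (hx : x ∉ W) (T : V →ₗ[k] V) (hT : W ≤ W.comap T) {c : k} (hc : T x - c • x ∈ W) :
    LinearMap.det T = c * LinearMap.det (T.restrict hT) := by
  rw [LinearMap.det_eq_det_mul_det W T hT, mul_comm]
  congr 1
  have : W.mapQ W T hT = c • LinearMap.id := by
    ext v
    obtain ⟨d, hd⟩ := exists_sub_smul_mem_of_finrank_quotient_eq_one hW hx v
    have hv : W.mkQ v = d • W.mkQ x := by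
      rw [← sub_eq_zero, ← map_smul, ← map_sub]
      exact (Submodule.Quotient.mk_eq_zero W).2 hd
    have hTx : W.mkQ (T x) = c • W.mkQ x := by
      rw [← sub_eq_zero, ← map_smul, ← map_sub]
      exact (Submodule.Quotient.mk_eq_zero W).2 hc
    have hm : ∀ y, W.mapQ W T hT (W.mkQ y) = W.mkQ (T y) := fun y => rfl
    simp only [LinearMap.comp_apply, LinearMap.smul_apply, LinearMap.id_apply]
    rw [hv, map_smul, hm, hTx, smul_comm]
  rw [this, LinearMap.det_smul, hW, LinearMap.det_id, pow_one, mul_one]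

/-- The flag $W\cap W'\subset W\subset V$ has two one-dimensional quotients, spanned by $y$ and $x$,
so the previous lemma applies twice. -/
theorem det_eq_mul_of_trivial_on_inf {W W' : Submodule k V}
    (hW : Module.finrank k (V ⧸ W) = 1) (hW' : Module.finrank k (V ⧸ W') = 1) {x y : V}
    (hx : x ∉ W) (hyW : y ∈ W) (hy : y ∉ W') (T : V →ₗ[k] V) (hTW : W ≤ W.comap T)
    (hT : ∀ u ∈ W, u ∈ W' → T u = u) {c d : k}
    (hc : T x - c • x ∈ W) (hd : T y - d • y ∈ W') : LinearMap.det T = c * d := by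
  rw [det_eq_mul_det_restrict hW hx T hTW hc]
  congr 1
  set U : Submodule k W := W'.comap W.subtype
  have hdec : ∀ v : W, ∃ t : k, v - t • (⟨y, hyW⟩ : W) ∈ U := fun v => by
    obtain ⟨t, ht⟩ := exists_sub_smul_mem_of_finrank_quotient_eq_one hW' hy (v : V)
    exact ⟨t, ht⟩
  have hyU : (⟨y, hyW⟩ : W) ∉ U := hy
  have hU : Module.finrank k (W ⧸ U) = 1 := by
    refine finrank_eq_one (U.mkQ ⟨y, hyW⟩) (by simpa using hyU) fun v => ?_
    obtain ⟨v, rfl⟩ := U.mkQ_surjective v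
    obtain ⟨t, ht⟩ := hdec v
    refine ⟨t, ?_⟩
    rw [eq_comm, ← sub_eq_zero, ← map_smul, ← map_sub]
    exact (Submodule.Quotient.mk_eq_zero U).2 ht
  have hTU : ∀ u : U, T.restrict hTW u = u := fun u => Subtype.ext (hT _ u.1.2 u.2)
  have hTU' : U ≤ U.comap (T.restrict hTW) := fun u hu => by
    rw [Submodule.mem_comap, hTU ⟨u, hu⟩]
    exact hu
  rw [det_eq_mul_det_restrict hU hyU (T.restrict hTW) hTU' (c := d) hd]
  have : (T.restrict hTW).restrict hTU' = LinearMap.id :=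
    LinearMap.ext fun u => Subtype.ext (hTU u)
  rw [this, LinearMap.det_id, mul_one]

end Determinant

end BraidedHq

namespace BraidedHq

/-! ### Transpositions that are diagonal at an element -/

section TranspositionCalculus

variable {k H A : Type*} [Field k] [Ring H] [Bialgebra k H] [Ring A] [Algebra k A]
  {s : H ⊗[k] A →ₗ[k] A ⊗[k] H}

/-- $k\to N$, $t\mapsto td$, is injective, and every module over a field is flat. -/
theorem tmul_right_injective {M N : Type*} [AddCommGroup M] [Module k M] [AddCommGroup N]
    [Module k N] {d : N} (hd : d ≠ 0) : Function.Injective fun m : M => m ⊗ₜ[k] d := by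
  have h := (Module.Flat.lTensor_preserves_injective_linearMap (M := M)
    (LinearMap.toSpanSingleton k N d) (smul_left_injective k hd)).comp
    (TensorProduct.rid k M).symm.injective
  intro m m' hm
  apply h
  simpa using hm

theorem tmul_left_injective {M N : Type*} [AddCommGroup M] [Module k M] [AddCommGroup N]
    [Module k N] {d : M} (hd : d ≠ 0) : Function.Injective (TensorProduct.mk k M N d) := by
  intro n n' hn
  apply tmul_right_injective (k := k) hd
  exact (TensorProduct.comm k M N).symm.injective (by simpa using hn)

theorem braidHH_tmul {d : H} {α : A →ₗ[k] A} (hα : ∀ a, s (d ⊗ₜ a) = α a ⊗ₜ d)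
    (z : H ⊗[k] A) :
    braidHH s (d ⊗ₜ z) = TensorProduct.map α (TensorProduct.mk k H H d) (s z) := by
  -- Stated for arbitrary $y$, since $s(z)$ need not be a pure tensor.
  have h : ∀ y : A ⊗[k] H, TensorProduct.assoc k A H H (s.rTensor H
      ((TensorProduct.assoc k H A H).symm (d ⊗ₜ y))) =
      TensorProduct.map α (TensorProduct.mk k H H d) y := by
    intro y
    induction y using TensorProduct.induction_on with
    | zero => simp
    | add y y' hy hy' => simp only [TensorProduct.tmul_add, map_add, hy, hy']
    | tmul a l => simp [hα]
  simpa [braidHH] using h (s z)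

/-- If `s(d ⊗ a) = α(a) ⊗ d`, then `s(l ⊗ a)` is determined by `(s ⊗ H)(H ⊗ s)(d ⊗ l ⊗ a)`. -/
theorem apply_tmul_of_braidHH_eq {d : H} (hd : d ≠ 0) {α : A →ₗ[k] A}
    (hinj : Function.Injective α) (hα : ∀ a, s (d ⊗ₜ a) = α a ⊗ₜ d) {l h : H} {a b : A}
    (hb : braidHH s (d ⊗ₜ (l ⊗ₜ a)) = α b ⊗ₜ (d ⊗ₜ h)) : s (l ⊗ₜ a) = b ⊗ₜ h := by
  refine TensorProduct.map_injective_of_flat_flat α (TensorProduct.mk k H H d) hinj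
    (tmul_left_injective hd) ?_
  rw [← braidHH_tmul hα, hb, TensorProduct.map_tmul, TensorProduct.mk_apply]

theorem diagAct_of_comul_eq {ρ : H →ₐ[k] Module.End k A} {h h₁ h₂ h₃ h₄ : H}
    (hΔ : Coalgebra.comul (R := k) h = h₁ ⊗ₜ h₂ + h₃ ⊗ₜ h₄) {a a₂ a₄ : A}
    (h2 : s (h₂ ⊗ₜ a) = a₂ ⊗ₜ h₂) (h4 : s (h₄ ⊗ₜ a) = a₄ ⊗ₜ h₄) (b : A) :
    diagAct s ρ h a b = ρ h₁ a₂ ⊗ₜ ρ h₂ b + ρ h₃ a₄ ⊗ₜ ρ h₄ b := by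
  simp [diagAct, hΔ, TensorProduct.add_tmul, h2, h4, actMap]

/-- Compatibility of $s$ with the action, at $d\otimes l\otimes a$, reads $\alpha(l\cdot a)\otimes
d=l\cdot\alpha(a)\otimes d$; cancel $d$. -/
theorem IsModuleAlgebra.map_comm {ρ : H →ₐ[k] Module.End k A} (hρ : IsModuleAlgebra s ρ)
    {d : H} (hd : d ≠ 0) {α : A →ₗ[k] A} (hα : ∀ a, s (d ⊗ₜ a) = α a ⊗ₜ d) (l : H) (a : A) :
    α (ρ l a) = ρ l (α a) := by
  have h := hρ.braided (d ⊗ₜ (l ⊗ₜ a))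
  apply tmul_right_injective (k := k) hd
  simpa [actMap, flipHH, hα] using h

end TranspositionCalculus

/-! ### Consequences for the generators of $H_q$ -/

section HqTransposition

variable {k A : Type*} [Field k] [Ring A] [Algebra k A] {q : kˣ}
  {s : Hq q ⊗[k] A →ₗ[k] A ⊗[k] Hq q} {α : A →ₗ[k] A} {β : A →ₗ[k] A}

/-- In the compatibility of $s$ with $\Delta(D_1)=D_1\otimes\sigma+1\otimes D_1$ the terms from
$1\otimes D_1$ agree; what remains determines $s$ at $\sigma$, because $D_1$ and $\alpha$ can be
cancelled. -/
theorem IsTransposition.apply_sig (hs : IsTransposition s) (hD : Hq.D1 q ≠ 0)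
    (hinj : Function.Injective α) (hα : ∀ a, s (Hq.D1 q ⊗ₜ a) = α a ⊗ₜ Hq.D1 q) (a : A) :
    s (Hq.sig q ⊗ₜ a) = a ⊗ₜ Hq.sig q := by
  refine apply_tmul_of_braidHH_eq hD hinj hα ?_
  have h := hs.comul_comp (Hq.D1 q) a
  have hΔ : Coalgebra.comul (R := k) (Hq.D1 q) = Hq.D1 q ⊗ₜ Hq.sig q + 1 ⊗ₜ Hq.D1 q :=
    Hq.comulHom_D1 q
  have h1 : braidHH s (1 ⊗ₜ (Hq.D1 q ⊗ₜ a)) = α a ⊗ₜ (1 ⊗ₜ Hq.D1 q) := by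
    rw [braidHH_tmul (α := LinearMap.id) hs.one_tmul, hα]
    rfl
  rw [hα, LinearMap.lTensor_tmul, hΔ, TensorProduct.tmul_add, TensorProduct.add_tmul, map_add,
    map_add, TensorProduct.assoc_tmul, TensorProduct.assoc_tmul, h1] at h
  exact (add_right_cancel h).symm

theorem IsGood.apply_D2 (hgood : IsGood s) (hD : Hq.D1 q ≠ 0)
    (hinj : Function.Injective α) (hα : ∀ a, s (Hq.D1 q ⊗ₜ a) = α a ⊗ₜ Hq.D1 q)
    (hβ : ∀ a, α (β a) = a) (a : A) :
    s (Hq.D2 q ⊗ₜ a) = β a ⊗ₜ Hq.D2 q :=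
  apply_tmul_of_braidHH_eq hD hinj hα (by rw [hgood, hβ])

variable {ρ : Hq q →ₐ[k] Module.End k A}

theorem IsModuleAlgebra.sig_mul (hρ : IsModuleAlgebra s ρ)
    (hσ : ∀ a, s (Hq.sig q ⊗ₜ a) = a ⊗ₜ Hq.sig q) (a b : A) :
    ρ (Hq.sig q) (a * b) = ρ (Hq.sig q) a * ρ (Hq.sig q) b := by
  -- The zero summand fits $\Delta(\sigma)$ to the two-term formula.
  have hΔ : Coalgebra.comul (R := k) (Hq.sig q) = Hq.sig q ⊗ₜ Hq.sig q + 0 ⊗ₜ 0 := by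
    rw [TensorProduct.tmul_zero, add_zero]
    exact Hq.comulHom_sig q
  rw [hρ.map_mul, diagAct_of_comul_eq hΔ (hσ a) (a₄ := 0) (by simp)]
  simp

theorem IsModuleAlgebra.D1_mul (hρ : IsModuleAlgebra s ρ)
    (hσ : ∀ a, s (Hq.sig q ⊗ₜ a) = a ⊗ₜ Hq.sig q)
    (hα : ∀ a, s (Hq.D1 q ⊗ₜ a) = α a ⊗ₜ Hq.D1 q) (a b : A) :
    ρ (Hq.D1 q) (a * b) = ρ (Hq.D1 q) a * ρ (Hq.sig q) b + α a * ρ (Hq.D1 q) b := by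
  rw [hρ.map_mul, diagAct_of_comul_eq (Hq.comulHom_D1 q) (hσ a) (hα a)]
  simp

theorem IsModuleAlgebra.D2_mul (hρ : IsModuleAlgebra s ρ)
    (hβ : ∀ a, s (Hq.D2 q ⊗ₜ a) = β a ⊗ₜ Hq.D2 q) (a b : A) :
    ρ (Hq.D2 q) (a * b) = ρ (Hq.D2 q) a * b + ρ (Hq.sig q) (β a) * ρ (Hq.D2 q) b := by
  rw [hρ.map_mul, diagAct_of_comul_eq (Hq.comulHom_D2 q) (hρ.transposition.one_tmul a) (hβ a)]
  simp

theorem sig_injective (ρ : Hq q →ₐ[k] Module.End k A) : Function.Injective (ρ (Hq.sig q)) := by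
  refine Function.LeftInverse.injective (g := ρ (Hq.sigInv q)) fun a => ?_
  rw [← Module.End.mul_apply, ← map_mul, Hq.sigInv_mul_sig, map_one, Module.End.one_apply]

theorem sig_D1_apply (ρ : Hq q →ₐ[k] Module.End k A) (a : A) :
    (q : k) • ρ (Hq.sig q) (ρ (Hq.D1 q) a) = ρ (Hq.D1 q) (ρ (Hq.sig q) a) := by
  rw [← Module.End.mul_apply, ← Module.End.mul_apply, ← map_mul, ← map_mul, ← Hq.sig_mul_D1,
    map_smul, LinearMap.smul_apply]

theorem sig_D2_apply (ρ : Hq q →ₐ[k] Module.End k A) (a : A) :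
    (q : k) • ρ (Hq.sig q) (ρ (Hq.D2 q) a) = ρ (Hq.D2 q) (ρ (Hq.sig q) a) := by
  rw [← Module.End.mul_apply, ← Module.End.mul_apply, ← map_mul, ← map_mul, ← Hq.sig_mul_D2,
    map_smul, LinearMap.smul_apply]

end HqTransposition

/-! ### Extending a diagonal transposition from generators -/

section CrossedTransposition

open Crossed

variable {k G V : Type*} [Field k] [Group G] [AddCommGroup V] [Module k V]
  {r : Representation k G V} {f : NormalCocycle G k}

/-- A transposition on `S(V) #_f G` that is diagonal at `d` on generators is diagonal at `d`. -/
theorem IsTransposition.apply_eq_diagMap {H : Type*} [Ring H] [Bialgebra k H]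
    {s : H ⊗[k] Crossed r f →ₗ[k] Crossed r f ⊗[k] H} (hs : IsTransposition s) {d : H}
    {e : V →ₗ[k] V} {c : G → k} (hV : ∀ v, s (d ⊗ₜ ofV r f v) = ofV r f (e v) ⊗ₜ d)
    (hG : ∀ g, s (d ⊗ₜ w r f g) = (c g • w r f g) ⊗ₜ d) (a : Crossed r f) :
    s (d ⊗ₜ a) = diagMap r f e c a ⊗ₜ d := by
  have hmul : ∀ {x x' y y' : Crossed r f}, s (d ⊗ₜ x) = x' ⊗ₜ d → s (d ⊗ₜ y) = y' ⊗ₜ d →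
      s (d ⊗ₜ (x * y)) = (x' * y') ⊗ₜ d := by
    intro x x' y y' hx hy
    rw [hs.tmul_mul]
    simp [braidAA, hx, hy]
  have h1 : ∀ P, s (d ⊗ₜ term r f 1 P) = term r f 1 (symMap e P) ⊗ₜ d := by
    intro P
    induction P using SymmetricAlgebra.induction with
    | algebraMap t =>
      rw [AlgHom.commutes, term_one_algebraMap, TensorProduct.tmul_smul, map_smul, hs.tmul_one,
        TensorProduct.smul_tmul']
    | ι v => rw [symMap_ι]; exact hV v
    | mul P Q hP hQ =>
      rw [map_mul, term_one_mul_term_one, hmul hP hQ, term_one_mul_term_one]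
    | add P Q hP hQ =>
      rw [map_add, term_add, TensorProduct.tmul_add, map_add, hP, hQ, term_add,
        TensorProduct.add_tmul]
  induction a using Crossed.induction with
  | h0 => simp
  | hadd a b ha hb => rw [TensorProduct.tmul_add, map_add, map_add, TensorProduct.add_tmul, ha, hb]
  | hterm g P =>
    rw [diagMap_term, ← term_one_mul_w, hmul (h1 P) (hG g), Crossed.mul_smul', term_one_mul_w]

end CrossedTransposition

end BraidedHq

/-! ### The main theorem -/

open BraidedHq BraidedHq.Crossed in
theorem mainTheorem8 {k G V : Type*} [Field k] [Group G] [AddCommGroup V] [Module k V]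
    [FiniteDimensional k V] (q : kˣ) (r : Representation k G V)
    (f : BraidedHq.NormalCocycle G k)
    -- the maps `α̂` and `χ_α`, and the good transposition `s` associated with them
    (alphaHat : V ≃ₗ[k] V) (halpha : ∀ (g : G) (v : V), alphaHat (r g v) = r g (alphaHat v))
    (chiAlpha : G →* kˣ)
    (s : BraidedHq.Hq q ⊗[k] BraidedHq.Crossed r f →ₗ[k]
      BraidedHq.Crossed r f ⊗[k] BraidedHq.Hq q)
    (hs : BraidedHq.IsTransposition s) (hgood : BraidedHq.IsGood s)
    (hsV : ∀ v : V, s (BraidedHq.Hq.D1 q ⊗ₜ BraidedHq.Crossed.ofV r f v) =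
      BraidedHq.Crossed.ofV r f (alphaHat v) ⊗ₜ BraidedHq.Hq.D1 q)
    (hsG : ∀ g : G, s (BraidedHq.Hq.D1 q ⊗ₜ BraidedHq.Crossed.w r f g) =
      ((chiAlpha g : k) • BraidedHq.Crossed.w r f g) ⊗ₜ BraidedHq.Hq.D1 q)
    -- the maps `ς̂`, `χ_ς`, `δ̂₁`, `δ̂₂`
    (sigmaHat : V →ₗ[k] V) (chiSigma : G → kˣ)
    (delta1 delta2 : V →ₗ[k] BraidedHq.Crossed r f)
    (hcodim1 : Module.finrank k (V ⧸ LinearMap.ker delta1) = 1)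
    (hcodim2 : Module.finrank k (V ⧸ LinearMap.ker delta2) = 1)
    (hker : LinearMap.ker delta1 ≠ LinearMap.ker delta2)
    -- the elements `x_i`, `g_{ij}`, `P^{(i)}_{g_{ij}}`
    (x1 x2 : V) (hx11 : x1 ∉ LinearMap.ker delta1) (hx22 : x2 ∉ LinearMap.ker delta2)
    (hx12 : x1 ∈ LinearMap.ker delta2) (hx21 : x2 ∈ LinearMap.ker delta1)
    (n1 n2 : ℕ) (g1 : Fin n1 → G) (g2 : Fin n2 → G)
    (hg1 : Function.Injective g1) (hg2 : Function.Injective g2)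
    (P1 : Fin n1 → SymmetricAlgebra k V) (P2 : Fin n2 → SymmetricAlgebra k V)
    (hP1 : ∀ j, P1 j ≠ 0) (hP2 : ∀ h, P2 h ≠ 0)
    (hdelta1 : delta1 x1 = ∑ j, BraidedHq.Crossed.term r f (g1 j) (P1 j))
    (hdelta2 : delta2 x2 = ∑ h, BraidedHq.Crossed.term r f (g2 h) (P2 h))
    -- the scalars `λ_{1g}` and `λ_{2g}`
    (lam1 lam2 : G → k)
    (hlam1 : ∀ g, r g x1 - lam1 g • x1 ∈ LinearMap.ker delta1)
    (hlam2 : ∀ g, r g x2 - lam2 g • x2 ∈ LinearMap.ker delta2)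
    -- the `H_q`-module algebra structure on `(A, s)`
    (ρ : BraidedHq.Hq q →ₐ[k] Module.End k (BraidedHq.Crossed r f))
    (hρ : BraidedHq.IsModuleAlgebra s ρ)
    (hsigV : ∀ v : V, ρ (BraidedHq.Hq.sig q) (BraidedHq.Crossed.ofV r f v) =
      BraidedHq.Crossed.ofV r f (sigmaHat v))
    (hsigG : ∀ g : G, ρ (BraidedHq.Hq.sig q) (BraidedHq.Crossed.w r f g) =
      (chiSigma g : k) • BraidedHq.Crossed.w r f g)
    (hD1V : ∀ v : V, ρ (BraidedHq.Hq.D1 q) (BraidedHq.Crossed.ofV r f v) = delta1 v)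
    (hD2V : ∀ v : V, ρ (BraidedHq.Hq.D2 q) (BraidedHq.Crossed.ofV r f v) = delta2 v)
    (hD1G : ∀ g : G, ρ (BraidedHq.Hq.D1 q) (BraidedHq.Crossed.w r f g) = 0)
    (hD2G : ∀ g : G, ρ (BraidedHq.Hq.D2 q) (BraidedHq.Crossed.w r f g) = 0)
    (hPS1 : ∀ j, P1 j ∈ BraidedHq.symSub (LinearMap.ker delta1))
    (hPS2 : ∀ h, P2 h ∈ BraidedHq.symSub (LinearMap.ker delta2)) :
    ∀ (j : Fin n1) (h : Fin n2),
      lam1 (g1 j) * lam1 (g2 h) = q ∧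
      lam2 (g1 j) * lam2 (g2 h) = (q : k)⁻¹ ∧
      LinearMap.det (r (g1 j * g2 h)) = 1 := by
  have hneD : ∀ {δ : V →ₗ[k] Crossed r f} {x : V}, x ∉ LinearMap.ker δ → δ x ≠ 0 :=
    fun hx h => hx (LinearMap.mem_ker.2 h)
  have hd1 := hneD hx11
  have hd2 := hneD hx22
  -- $D_1$ acts nontrivially on $x_1$; this permits cancelling $\otimes D_1$ below.
  have hD : Hq.D1 q ≠ 0 := by
    intro h0
    rw [← hD1V, h0, map_zero] at hd1
    exact hd1 rfl
  -- the diagonal maps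
  set α : Crossed r f →ₗ[k] Crossed r f := diagMap r f alphaHat (fun g => chiAlpha g) with hα_def
  set β : Crossed r f →ₗ[k] Crossed r f :=
    diagMap r f alphaHat.symm (fun g => ((chiAlpha g)⁻¹ : kˣ)) with hβ_def
  have hαβ : ∀ a, α (β a) = a := fun a => by
    rw [hα_def, hβ_def, diagMap_diagMap]
    simpa using diagMap_id_one a
  have hβα : ∀ a, β (α a) = a := fun a => by
    rw [hα_def, hβ_def, diagMap_diagMap]
    simpa using diagMap_id_one a
  have hinj : Function.Injective α := Function.LeftInverse.injective hβα
  have hαV : ∀ v, α (ofV r f v) = ofV r f (alphaHat v) := diagMap_ofV _ _ (by simp)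
  have hα : ∀ a, s (Hq.D1 q ⊗ₜ a) = α a ⊗ₜ Hq.D1 q := hs.apply_eq_diagMap hsV hsG
  have hσ := hs.apply_sig hD hinj hα
  have hβ := hgood.apply_D2 hD hinj hα hαβ
  have hone : ρ (Hq.sig q) 1 = 1 := by
    rw [hρ.map_one, show Coalgebra.counit (R := k) (Hq.sig q) = 1 from Hq.counitHom_sig q,
      one_smul]
  -- $\chi_\varsigma$ is only a map, so its value at $1$ comes from $w_1=1$ and $\sigma\cdot1=1$.
  have hchi1 : (chiSigma 1 : k) = 1 := by
    have h := (hsigG 1).symm.trans hone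
    rw [w, ← one_def] at h
    have h1 : (1 : Crossed r f) ≠ 0 := fun h0 => hd1 (by rw [← mul_one (delta1 x1), h0, mul_zero])
    exact smul_left_injective k h1 (h.trans (one_smul k _).symm)
  set ς := ρ (Hq.sig q) with hς_def
  have hς : ς = diagMap r f sigmaHat (fun g => chiSigma g) :=
    eq_diagMap ς hone (hρ.sig_mul hσ) _ _ hsigV hsigG
  have hςβ : ∀ a, ς (β a) = diagMap r f (sigmaHat ∘ₗ alphaHat.symm)
      (fun g => (chiSigma g : k) * ((chiAlpha g)⁻¹ : kˣ)) a := fun a => by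
    rw [hς, hβ_def, diagMap_diagMap]
  have hder1 : ∀ x y, ρ (Hq.D1 q) (x * y) =
      ρ (Hq.D1 q) x * diagMap r f sigmaHat (fun g => chiSigma g) y +
        diagMap r f alphaHat (fun g => chiAlpha g) x * ρ (Hq.D1 q) y := fun x y => by
    rw [← hς, hρ.D1_mul hσ hα]
  have hder2 : ∀ x y, ρ (Hq.D2 q) (x * y) =
      ρ (Hq.D2 q) x * diagMap r f LinearMap.id (fun _ => 1) y +
        diagMap r f (sigmaHat ∘ₗ alphaHat.symm)
          (fun g => (chiSigma g : k) * ((chiAlpha g)⁻¹ : kˣ)) x * ρ (Hq.D2 q) y := fun x y => by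
    rw [diagMap_id_one, ← hςβ, hρ.D2_mul hβ]
  -- compatibility of `delta1`, `delta2` with `α̂`, `ς̂` and `G`
  have hαd1 : ∀ v, delta1 (alphaHat v) = α (delta1 v) := fun v => by
    rw [← hD1V, ← hD1V, ← hαV, hρ.map_comm hD hα]
  have hαd2 : ∀ v, delta2 (alphaHat v) = α (delta2 v) := fun v => by
    rw [← hD2V, ← hD2V, ← hαV, hρ.map_comm hD hα]
  have hςd1 : ∀ v, delta1 (sigmaHat v) = (q : k) • ς (delta1 v) := fun v => by
    rw [← hD1V, ← hD1V, ← hsigV, sig_D1_apply]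
  have hςd2 : ∀ v, delta2 (sigmaHat v) = (q : k) • ς (delta2 v) := fun v => by
    rw [← hD2V, ← hD2V, ← hsigV, sig_D2_apply]
  have hval : ∀ {δ : V →ₗ[k] Crossed r f} {v x : V} {c : k}, v - c • x ∈ LinearMap.ker δ →
      δ v = c • δ x := fun h => by
    rwa [LinearMap.mem_ker, map_sub, map_smul, sub_eq_zero] at h
  have hval' : ∀ {δ : V →ₗ[k] Crossed r f} {v x : V} {c : k}, δ v = c • δ x →
      v - c • x ∈ LinearMap.ker δ := fun h => by
    rwa [LinearMap.mem_ker, map_sub, map_smul, sub_eq_zero]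
  have hker1 : ∀ g v, delta1 v = 0 → delta1 (r g v) = 0 := fun g v hv => by
    rw [← hD1V] at hv ⊢
    exact skewDer_ker hder1 hD1G (fun g => Units.ne_zero _) g hv
  have hker2 : ∀ g v, delta2 v = 0 → delta2 (r g v) = 0 := fun g v hv => by
    rw [← hD2V] at hv ⊢
    exact skewDer_ker hder2 hD2G (fun g => one_ne_zero) g hv
  have hG1 : ∀ g v c, delta1 v = c • delta1 x1 → delta1 (r g v) = (c * lam1 g) • delta1 x1 := by
    intro g v c h
    have h1 := hker1 g _ (hval' h)
    rw [map_sub, map_sub, map_smul, map_smul, hval (hlam1 g), smul_smul, sub_eq_zero] at h1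
    exact h1
  have hG2 : ∀ g v c, delta2 v = c • delta2 x2 → delta2 (r g v) = (c * lam2 g) • delta2 x2 := by
    intro g v c h
    have h1 := hker2 g _ (hval' h)
    rw [map_sub, map_sub, map_smul, map_smul, hval (hlam2 g), smul_smul, sub_eq_zero] at h1
    exact h1
  -- eigenvalues
  obtain ⟨a1, ha1⟩ := exists_sub_smul_mem_of_finrank_quotient_eq_one hcodim1 hx11 (alphaHat x1)
  obtain ⟨a2, ha2⟩ := exists_sub_smul_mem_of_finrank_quotient_eq_one hcodim2 hx22 (alphaHat x2)
  obtain ⟨s1, hs1⟩ := exists_sub_smul_mem_of_finrank_quotient_eq_one hcodim1 hx11 (sigmaHat x1)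
  obtain ⟨s2, hs2⟩ := exists_sub_smul_mem_of_finrank_quotient_eq_one hcodim2 hx22 (sigmaHat x2)
  replace ha1 := hval ha1
  replace ha2 := hval ha2
  replace hs1 := hval hs1
  replace hs2 := hval hs2
  have hq : (q : k) ≠ 0 := q.ne_zero
  have ha1' : a1 ≠ 0 := by
    rintro rfl
    rw [hαd1, zero_smul] at ha1
    exact hd1 (hinj (ha1.trans (map_zero α).symm))
  have ha2' : a2 ≠ 0 := by
    rintro rfl
    rw [hαd2, zero_smul] at ha2
    exact hd2 (hinj (ha2.trans (map_zero α).symm))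
  have hs2' : s2 ≠ 0 := by
    rintro rfl
    rw [hςd2, zero_smul, smul_eq_zero, or_iff_right hq] at hs2
    exact hd2 (sig_injective ρ (hs2.trans (map_zero ς).symm))
  have hς1 : ς (delta1 x1) = ((q : k)⁻¹ * s1) • delta1 x1 := by
    rw [mul_smul, ← hs1, hςd1, inv_smul_smul₀ hq]
  have hςβ2 : ς (β (delta2 x2)) = (a2⁻¹ * ((q : k)⁻¹ * s2)) • delta2 x2 := by
    have h1 : β (delta2 x2) = a2⁻¹ • delta2 x2 := by
      rw [eq_inv_smul_iff₀ ha2', ← map_smul, ← ha2, hαd2, hβα]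
    rw [h1, map_smul, mul_smul, mul_smul, ← hs2, hςd2, inv_smul_smul₀ hq]
  intro j h
  have hcoeff1 : coeff r f (g1 j) (ρ (Hq.D1 q) (ofV r f x1)) = P1 j := by
    rw [hD1V, hdelta1, coeff_sum_term hg1]
  have hcoeff2 : coeff r f (g2 h) (ρ (Hq.D2 q) (ofV r f x2)) = P2 h := by
    rw [hD2V, hdelta2, coeff_sum_term hg2]
  have hact1 : ∀ v, delta1 v = 0 → r (g1 j) (sigmaHat v) = alphaHat v := fun v hv =>
    skewDer_eq_on_ker (x := x1) hder1 hchi1 (by simp) (by rw [hcoeff1]; exact hP1 j)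
      (by rw [hD1V, hv])
  have hact2 : ∀ v, delta2 v = 0 → r (g2 h) v = sigmaHat (alphaHat.symm v) := fun v hv =>
    skewDer_eq_on_ker (x := x2) hder2 rfl (by simp [hchi1]) (by rw [hcoeff2]; exact hP2 h)
      (by rw [hD2V, hv])
  -- $D_1$ has $B=q^{-1}s_1$ (from $\varsigma$) and $C=a_1$ (from $\alpha$).
  have h11 : lam1 (g1 j) * ((q : k)⁻¹ * s1) = a1 := by
    refine skewDer_eigenvalue (x := x1) (g := g1 j) (U := LinearMap.ker delta1) hder1 hD1G hchi1
      (by simp) (fun g => Units.ne_zero _) (fun v hv => by rw [hD1V]; exact hv)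
      (by rw [hcoeff1]; exact hP1 j) (by rw [hcoeff1]; exact hPS1 j) ?_ ?_ ?_
    · rw [hD1V, ← hς, hς1]
    · rw [hD1V, ← hα_def, ← hαd1, ha1]
    · rw [hD1V, hD1V, hval (hlam1 _)]
  -- $D_2$ has $B=1$ and $C=a_2^{-1}q^{-1}s_2$ (from $\varsigma\alpha^{-1}$).
  have h22 : lam2 (g2 h) * 1 = a2⁻¹ * ((q : k)⁻¹ * s2) := by
    refine skewDer_eigenvalue (x := x2) (g := g2 h) (U := LinearMap.ker delta2) hder2 hD2G rfl
      (by simp [hchi1]) (fun g => one_ne_zero) (fun v hv => by rw [hD2V]; exact hv)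
      (by rw [hcoeff2]; exact hP2 h) (by rw [hcoeff2]; exact hPS2 h) ?_ ?_ ?_
    · rw [diagMap_id_one, one_smul]
    · rw [hD2V, ← hςβ, hςβ2]
    · rw [hD2V, hD2V, hval (hlam2 _)]
  -- $\hat\alpha(x_1)$ lies in $\ker\hat\delta_2$, where $g_{2h}=\hat\varsigma\hat\alpha^{-1}$; so
  -- $g_{2h}$ sends it to $\hat\varsigma(x_1)$.
  have h12 : a1 * lam1 (g2 h) = s1 := by
    have h1 := hG1 (g2 h) _ _ ha1
    rw [hact2 _ (by rw [hαd2, LinearMap.mem_ker.1 hx12, map_zero]),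
      LinearEquiv.symm_apply_apply, hs1] at h1
    exact (smul_left_injective k hd1 h1).symm
  -- Symmetrically, $x_2\in\ker\hat\delta_1$, where $g_{1j}\hat\varsigma=\hat\alpha$.
  have h21 : s2 * lam2 (g1 j) = a2 := by
    have h1 := hG2 (g1 j) _ _ hs2
    rw [hact1 _ hx21, ha2] at h1
    exact (smul_left_injective k hd2 h1).symm
  have hres1 : lam1 (g1 j) * lam1 (g2 h) = q := by
    have hs1' : lam1 (g1 j) * s1 = q * a1 := by
      rw [← h11]
      field_simp
    apply mul_left_cancel₀ ha1'
    linear_combination lam1 (g1 j) * h12 + hs1'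
  have hres2 : lam2 (g1 j) * lam2 (g2 h) = (q : k)⁻¹ := by
    rw [mul_one] at h22
    apply mul_left_cancel₀ hs2'
    rw [← mul_assoc, h21, h22, mul_inv_cancel_left₀ ha2', mul_comm]
  refine ⟨hres1, hres2, ?_⟩
  rw [← mul_inv_cancel₀ hq]
  refine det_eq_mul_of_trivial_on_inf hcodim1 hcodim2 hx11 hx21 hx22 _
    (fun v hv => hker1 _ _ hv) (fun u hu1 hu2 => ?_) (hval' ?_) (hval' ?_)
  -- For $u$ in both kernels, $g_{2h}u=\hat\varsigma(\hat\alpha^{-1}u)$, and $g_{1j}$ returns this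
  -- to $u$ because $\hat\alpha^{-1}u$ is still in $\ker\hat\delta_1$.
  · have hu : delta1 (alphaHat.symm u) = 0 := by
      apply hinj
      rw [← hαd1, LinearEquiv.apply_symm_apply, map_zero]
      exact hu1
    rw [map_mul, Module.End.mul_apply, hact2 u hu2, hact1 _ hu, LinearEquiv.apply_symm_apply]
  · rw [map_mul, Module.End.mul_apply, hG1 _ _ _ (hval (hlam1 _)), mul_comm, hres1]
  · rw [map_mul, Module.End.mul_apply, hG2 _ _ _ (hval (hlam2 _)), mul_comm, hres2]
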